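/- Let $X$ be a $T_1$ topological space with topology $\tau$ and let $\kappa$ be a cardinal. A transfinite sequence $\langle x_\alpha:\alpha<\eta\rangle$ of points of $X$ is called a free sequence if $\overline{\{x_\alpha:\alpha<\beta\}}\cap\overline{\{x_\alpha:\beta\le\alpha<\eta\}}=\emptyset$ for every $\beta<\eta$; a set $D\subseteq X$ is called free if it has a well-ordering that turns it into a free sequence. Let $\mathcal F(X)$ be the family of all free subsets of $X$, and let $\widehat F(X)$ be the smallest cardinal $\nu$ such that $X$ has no free subset of size $\nu$. For $A\subseteq X$, let $\psi(A,X)$ be the smallest size of a family of open subsets of $X$ whose intersection is $A$. For an uncountable regular cardinal $\lambda$, let $H(\lambda)$ be the set of all sets whose transitive closure has cardinality less than $\lambda$. Let $M$ be an elementary submodel of $\langle H(\lambda),\in\rangle$ for some such $\lambda$, with $\langle X,\tau\rangle\in M$ and $\mu+1\subseteq M$, where $\mu=|M|$. Suppose that $M$ is $<\kappa$-closed, i.e. for every cardinal $\varrho<\kappa$ every function from $\varrho$ to $M$ is an element of $M$. Let $\mathcal D=\mathcal F(X)\cap[X\cap M]^{<\kappa}$ be the family of all free subsets $D$ of $X$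 with $D\subseteq X\cap M$ and $|D|<\kappa$. If $\psi(\overline D,X)\le\mu$ for every $D\in\mathcal D$, then either $$X=\bigcup\{\overline D: D\in\mathcal D\}$$ or $\widehat F(X)>\kappa$, i.e. there is a free subset of $X$ of size $\kappa$. -/

import Mathlib

open Cardinal FirstOrder

universe u v

/-! ### Topological notions -/

section Topological

variable {X : Type v} [TopologicalSpace X]

/-- The pseudocharacter `ψ(A, X)`: the smallest size of a family of open sets whose intersection
is `A`. (In a `T1` space such families exist for every `A`.) -/
noncomputable def pseudocharacter (A : Set X) : Cardinal.{v} :=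
  sInf {c | ∃ V : Set (Set X), (∀ U ∈ V, IsOpen U) ∧ ⋂₀ V = A ∧ #V = c}

/-- A sequence `x` indexed by `ι`, which is well-ordered by the strict order `r`, is a free sequence
if for every `b` the closures of `{x a : a < b}` and `{x a : b ≤ a}` are disjoint. -/
def IsFreeSequence {ι : Type*} (r : ι → ι → Prop) [IsWellOrder ι r] (x : ι → X) : Prop :=
  ∀ b, Disjoint (closure (x '' {a | r a b})) (closure (x '' {a | ¬ r a b}))

/-- A set is free if it has a well-ordering that turns it into a free sequence. -/
def IsFreeSet (D : Set X) : Prop :=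
  ∃ (r : D → D → Prop) (_ : IsWellOrder D r), IsFreeSequence r (fun d : D => (d : X))

variable (X) in
/-- `F̂(X)`: the smallest cardinal `c` such that `X` has no free subset of size `c`. -/
noncomputable def freenessHat : Cardinal.{v} :=
  sInf {c | ¬ ∃ D : Set X, IsFreeSet D ∧ #D = c}

end Topological

/-! ### Models of set theory -/

/-- The relation symbols of the language of set theory: a single binary one. -/
inductive SetTheoryRel : ℕ → Type
  | mem : SetTheoryRel 2

/-- The first-order language of set theory. -/
def setLanguage : FirstOrder.Language.{0, 0} := ⟨fun _ => Empty, SetTheoryRel⟩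

/-- The membership symbol. -/
def memSymbol : setLanguage.Relations 2 := SetTheoryRel.mem

/-- A set or class `A` of sets, as a structure with the true membership relation. -/
instance memStructure (A : Set ZFSet.{u}) : setLanguage.Structure A where
  funMap f := nomatch f
  RelMap
    | SetTheoryRel.mem => fun v => (v 0 : ZFSet) ∈ (v 1 : ZFSet)

/-- Atomic formulas of the language of set theory mean what they should. -/
theorem realize_memSymbol (A : Set ZFSet.{u}) {α : Type*} {n : ℕ}
    (s t : setLanguage.Term (α ⊕ Fin n)) (v : α → A) (xs : Fin n → A) :
    (memSymbol.boundedFormula₂ s t).Realize v xs ↔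
      (s.realize (Sum.elim v xs) : A).1 ∈ (t.realize (Sum.elim v xs) : A).1 := by
  rw [FirstOrder.Language.BoundedFormula.realize_rel₂]
  rfl

/-- `H(θ)`: the sets whose transitive closure has cardinality less than `θ`, i.e. that are included
in some transitive set of cardinality less than `θ`. -/
def hereditarySets (θ : Cardinal.{u}) : Set ZFSet.{u} :=
  {x | ∃ t : ZFSet.{u}, t.IsTransitive ∧ x ⊆ t ∧ t.card < θ}

/-- `M` is an elementary submodel of `N`: `M ⊆ N` and the inclusion is an elementary embedding. -/
def IsElementarySubmodel (M : ZFSet.{u}) (N : Set ZFSet.{u}) : Prop :=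
  ∃ f : (M : Set ZFSet.{u}) ↪ₑ[setLanguage] N, ∀ x, (f x : ZFSet.{u}) = x

/-- `M` is `<κ`-closed: for every cardinal `ϱ < κ` (viewed as an initial von Neumann ordinal),
every function from `ϱ` to `M` is an element of `M`. -/
def IsLTClosed (κ : Cardinal.{u}) (M : ZFSet.{u}) : Prop :=
  ∀ ϱ < κ, ∀ f : ZFSet.{u}, ZFSet.IsFunc ϱ.ord.toZFSet M f → f ∈ M

/-! ### Spaces as sets -/

/-- The topology of a space with underlying set `S`, as a set: the set of all open subsets
of `S`. -/
noncomputable def topologySet (S : ZFSet.{u}) [TopologicalSpace S] : ZFSet.{u} :=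
  S.powerset.sep (fun U => IsOpen {x : S | (x : ZFSet.{u}) ∈ U})

/-- A space, as a set: the ordered pair of its underlying set and its topology. -/
noncomputable def spaceSet (S : ZFSet.{u}) [TopologicalSpace S] : ZFSet.{u} :=
  ZFSet.pair S (topologySet S)

/-- The free subsets of `X` that are included in `M` and have size less than `κ`. -/
def smallFreeSets (X : ZFSet.{u}) [TopologicalSpace X] (κ : Cardinal.{u}) (M : ZFSet.{u}) :
    Set (Set X) :=
  {D | IsFreeSet D ∧ (∀ x ∈ D, (x : ZFSet.{u}) ∈ M) ∧ #D < lift.{u + 1} κ}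

/-! ### First-order definability over a set of sets -/

/-! Suppose a point `p` lies in no closure of a small free subset of `X ∩ M`. By recursion on `α <
κ`, points `x_α ∈ X ∩ M` and open sets `U_α ∈ M` are chosen so that `U_α` includes the closure of
`{x_β : β < α}` and omits `p`, and `x_α ∉ U_β` for all `β ≤ α`. Then `U_α` separates each initial
segment from its tail (`injective_and_isFreeSet_range`), so the `x_α` form a free set of size `κ`.

At stage `α`, `D = {x_β : β < α}` is already free, and it is in `M` by `<κ`-closure; hence so is its
closure, being definable. Since `ψ ≤ μ`, this closure is the intersection of open sets indexed by
`μ`. By elementarity such an indexed family lies in `M`, and `μ ⊆ M` puts all its members in `M`;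
one of them omits `p` and serves as `U_α` (`exists_isOpen_superset`). By closure again `{U_β : β <
α} ∈ M`. The point `p` shows that these sets and `U_α` do not cover `X`, so elementarity gives `x_α
∈ M` outside all of them (`exists_notMem`). -/

/-- A relation on `N` is first-order if some formula of the language of set theory defines it. -/
def IsFirstOrder {N : Set ZFSet.{u}} {α : Type} (P : (α → N) → Prop) : Prop :=
  ∃ φ : setLanguage.Formula α, ∀ v, φ.Realize v ↔ P v

namespace IsFirstOrder

variable {N : Set ZFSet.{u}} {α : Type}

theorem mem (a b : α) : IsFirstOrder fun v : α → N => (v a : ZFSet) ∈ (v b : ZFSet) :=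
  ⟨memSymbol.formula₂ (.var a) (.var b), fun v => by
    rw [FirstOrder.Language.Formula.realize_rel₂]; rfl⟩

theorem eq (a b : α) : IsFirstOrder fun v : α → N => v a = v b :=
  ⟨Language.Term.equal (.var a) (.var b), fun v => by
    rw [Language.Formula.realize_equal]; rfl⟩

variable {P Q : (α → N) → Prop}

theorem congr (hP : IsFirstOrder P) (h : ∀ v, P v ↔ Q v) : IsFirstOrder Q :=
  let ⟨φ, hφ⟩ := hP
  ⟨φ, fun v => (hφ v).trans (h v)⟩

theorem not (hP : IsFirstOrder P) : IsFirstOrder fun v => ¬ P v :=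
  let ⟨φ, hφ⟩ := hP
  ⟨φ.not, fun v => by rw [Language.Formula.realize_not, hφ]⟩

theorem imp (hP : IsFirstOrder P) (hQ : IsFirstOrder Q) : IsFirstOrder fun v => P v → Q v :=
  let ⟨φ, hφ⟩ := hP
  let ⟨ψ, hψ⟩ := hQ
  ⟨φ.imp ψ, fun v => by rw [Language.Formula.realize_imp, hφ, hψ]⟩

theorem and (hP : IsFirstOrder P) (hQ : IsFirstOrder Q) : IsFirstOrder fun v => P v ∧ Q v :=
  (hP.imp hQ.not).not.congr fun v => by tauto

theorem or (hP : IsFirstOrder P) (hQ : IsFirstOrder Q) : IsFirstOrder fun v => P v ∨ Q v :=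
  (hP.not.imp hQ).congr fun v => by tauto

theorem iff (hP : IsFirstOrder P) (hQ : IsFirstOrder Q) : IsFirstOrder fun v => P v ↔ Q v :=
  ((hP.imp hQ).and (hQ.imp hP)).congr fun v => by tauto

/-- The bound variable is `none` and `some` shifts the older ones, so variables under nested
quantifiers read as de Bruijn indices. -/
theorem ex {P : (α → N) → N → Prop}
    (hP : IsFirstOrder fun w : Option α → N => P (fun j => w (some j)) (w none)) :
    IsFirstOrder fun v => ∃ x, P v x := by
  obtain ⟨φ, hφ⟩ := hP
  let g : Option α → α ⊕ Unit := fun o => o.elim (.inr ()) .inl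
  refine ⟨(φ.relabel g).iExs Unit, fun v => ?_⟩
  rw [Language.Formula.realize_iExs]
  simp only [Language.Formula.realize_relabel, hφ]
  exact ⟨fun ⟨i, hi⟩ => ⟨i (), hi⟩, fun ⟨x, hx⟩ => ⟨fun _ => x, hx⟩⟩

theorem all {P : (α → N) → N → Prop}
    (hP : IsFirstOrder fun w : Option α → N => P (fun j => w (some j)) (w none)) :
    IsFirstOrder fun v => ∀ x, P v x :=
  (ex (P := fun v x => ¬ P v x) hP.not).not.congr fun v => by push Not; rfl

/-- Kuratowski pairs are absolute for `N`: transitivity lets quantifiers over `N` see all members of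
a set, and closure under pairing puts `{a}` and `{a, b}` in `N`. -/
theorem pair_mem (htrans : ∀ x ∈ N, ∀ y ∈ x, y ∈ N)
    (hpair : ∀ x ∈ N, ∀ y ∈ N, ({x, y} : ZFSet) ∈ N) (a b c : α) :
    IsFirstOrder fun v : α → N => ZFSet.pair (v a) (v b) ∈ (v c : ZFSet) := by
  have key : IsFirstOrder fun v : α → N => ∃ p : N, p.1 ∈ (v c).1 ∧ ∀ z : N, z.1 ∈ p.1 ↔
      (∀ w : N, w.1 ∈ z.1 ↔ w = v a) ∨ (∀ w : N, w.1 ∈ z.1 ↔ (w = v a ∨ w = v b)) := by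
    refine ex (.and (mem none (some c)) (all (.iff (mem none (some none)) (.or (all ?_) (all ?_)))))
    · exact .iff (mem none (some none)) (eq none (some (some (some a))))
    · exact .iff (mem none (some none))
        (.or (eq none (some (some (some a)))) (eq none (some (some (some b)))))
  refine key.congr fun v => ?_
  have ha : ({(v a).1} : ZFSet) ∈ N := by simpa using hpair _ (v a).2 _ (v a).2
  have hab : ({(v a).1, (v b).1} : ZFSet) ∈ N := hpair _ (v a).2 _ (v b).2
  have h1 : ∀ z : N, (∀ w : N, w.1 ∈ z.1 ↔ w = v a) ↔ z.1 = {(v a).1} := by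
    refine fun z => ⟨fun h => ?_, fun h w => by rw [h, ZFSet.mem_singleton, Subtype.ext_iff]⟩
    ext w
    rw [ZFSet.mem_singleton]
    exact ⟨fun hw => congrArg Subtype.val ((h ⟨w, htrans _ z.2 _ hw⟩).1 hw),
      fun hw => hw ▸ (h (v a)).2 rfl⟩
  have h2 : ∀ z : N, (∀ w : N, w.1 ∈ z.1 ↔ (w = v a ∨ w = v b)) ↔
      z.1 = {(v a).1, (v b).1} := by
    refine fun z => ⟨fun h => ?_, fun h w => by
      rw [h, ZFSet.mem_pair, Subtype.ext_iff, Subtype.ext_iff]⟩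
    ext w
    rw [ZFSet.mem_pair]
    refine ⟨fun hw => ?_, fun hw => ?_⟩
    · simpa [Subtype.ext_iff] using (h ⟨w, htrans _ z.2 _ hw⟩).1 hw
    · rcases hw with rfl | rfl
      · exact (h (v a)).2 (.inl rfl)
      · exact (h (v b)).2 (.inr rfl)
  simp only [h1, h2]
  constructor
  · rintro ⟨p, hp, h⟩
    convert hp
    ext z
    rw [ZFSet.pair, ZFSet.mem_pair]
    refine ⟨fun hz => ?_, fun hz => (h ⟨z, htrans _ p.2 _ hz⟩).1 hz⟩
    exact (h ⟨z, by rcases hz with rfl | rfl <;> assumption⟩).2 hz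
  · exact fun h => ⟨⟨_, htrans _ (v c).2 _ h⟩, h, fun z => ZFSet.mem_pair⟩

end IsFirstOrder

/-- An elementary submodel contains a witness of each true first-order existential statement about
its elements. -/
theorem IsElementarySubmodel.exists_mem {M : ZFSet.{u}} {N : Set ZFSet.{u}}
    (hM : IsElementarySubmodel M N) {α : Type} {P : (α → N) → N → Prop}
    (hP : IsFirstOrder fun w : Option α → N => P (fun j => w (some j)) (w none))
    (v : α → N) (hv : ∀ i, (v i : ZFSet) ∈ M) (h : ∃ x, P v x) :
    ∃ x : N, (x : ZFSet) ∈ M ∧ P v x := by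
  obtain ⟨f, hf⟩ := hM
  obtain ⟨φ, hφ⟩ := hP
  let g : Option α → α ⊕ Unit := fun o => o.elim (.inr ()) .inl
  let v' : α → (M : Set ZFSet.{u}) := fun i => ⟨v i, hv i⟩
  have hv' : f ∘ v' = v := funext fun i => Subtype.ext (hf _)
  have h' : ((φ.relabel g).iExs Unit).Realize (f ∘ v') := by
    rw [hv', Language.Formula.realize_iExs]
    obtain ⟨x, hx⟩ := h
    exact ⟨fun _ => x, by rw [Language.Formula.realize_relabel, hφ]; exact hx⟩
  -- Elementarity takes the existential statement down to `M`, then takes the instance found there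
  -- back up to `N`.
  rw [f.map_formula, Language.Formula.realize_iExs] at h'
  obtain ⟨i, hi⟩ := h'
  rw [← f.map_formula, Language.Formula.realize_relabel, hφ] at hi
  refine ⟨f (i ()), (hf (i ())).symm ▸ (i ()).2, ?_⟩
  rw [← hv']
  exact hi

theorem IsElementarySubmodel.subset {M : ZFSet.{u}} {N : Set ZFSet.{u}}
    (hM : IsElementarySubmodel M N) {x : ZFSet.{u}} (hx : x ∈ M) : x ∈ N := by
  obtain ⟨f, hf⟩ := hM
  have := (f ⟨x, hx⟩).2
  rwa [hf] at this

/-! ### Hereditarily small sets -/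

section Hereditary

variable {θ : Cardinal.{u}} {x y : ZFSet.{u}}

theorem mem_hereditarySets_of_subset (hy : y ∈ hereditarySets θ) (h : x ⊆ y) :
    x ∈ hereditarySets θ :=
  let ⟨t, ht, hyt, hc⟩ := hy
  ⟨t, ht, fun _ hz => hyt (h hz), hc⟩

theorem mem_hereditarySets_of_mem (hy : y ∈ hereditarySets θ) (h : x ∈ y) :
    x ∈ hereditarySets θ :=
  let ⟨t, ht, hyt, hc⟩ := hy
  ⟨t, ht, ht.subset_of_mem (hyt h), hc⟩

theorem card_lt_of_mem_hereditarySets (hx : x ∈ hereditarySets θ) : x.card < θ :=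
  let ⟨_, _, hxt, hc⟩ := hx
  (ZFSet.card_mono hxt).trans_lt hc

/-- The sets `t y ∪ {y}` for `y ∈ x` have a transitive union that includes `x`; regularity keeps it
smaller than `θ`. -/
theorem mem_hereditarySets_of_card_lt (hθ : θ.IsRegular) (hx : x.card < θ)
    (h : ∀ y ∈ x, y ∈ hereditarySets θ) : x ∈ hereditarySets θ := by
  choose! t ht hyt hc using h
  let s : Shrink.{u} x → ZFSet.{u} := fun i => insert ((equivShrink x).symm i).1
    (t ((equivShrink x).symm i).1)
  refine ⟨ZFSet.iUnion s, ?_, fun y hy => ?_, ?_⟩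
  · refine ZFSet.IsTransitive.iUnion fun i => ?_
    intro z hz w hw
    rcases ZFSet.mem_insert_iff.1 hz with rfl | hz
    · exact ZFSet.mem_insert_of_mem _ (hyt _ ((equivShrink x).symm i).2 hw)
    · exact ZFSet.mem_insert_of_mem _ (ht _ ((equivShrink x).symm i).2 _ hz hw)
  · refine ZFSet.mem_iUnion.2 ⟨equivShrink x ⟨y, hy⟩, ?_⟩
    simp
  · have := ZFSet.lift_card_iUnion_le_sum_card (f := s)
    rw [Cardinal.lift_id] at this
    refine this.trans_lt (Cardinal.sum_lt_of_isRegular hθ hx fun i => ?_)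
    exact ZFSet.card_insert_le.trans_lt (Cardinal.add_lt_of_lt hθ.aleph0_le
      (hc _ ((equivShrink x).symm i).2) (Cardinal.one_lt_aleph0.trans_le hθ.aleph0_le))

theorem unordered_pair_mem_hereditarySets (hθ : θ.IsRegular) (hx : x ∈ hereditarySets θ)
    (hy : y ∈ hereditarySets θ) : ({x, y} : ZFSet) ∈ hereditarySets θ := by
  refine mem_hereditarySets_of_card_lt hθ ?_ fun z hz => ?_
  · refine ZFSet.card_insert_le.trans_lt (lt_of_lt_of_le ?_ hθ.aleph0_le)
    rw [ZFSet.card_singleton, one_add_one_eq_two]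
    exact Cardinal.ofNat_lt_aleph0
  · rcases ZFSet.mem_pair.1 hz with rfl | rfl <;> assumption

theorem pair_mem_hereditarySets (hθ : θ.IsRegular) (hx : x ∈ hereditarySets θ)
    (hy : y ∈ hereditarySets θ) : ZFSet.pair x y ∈ hereditarySets θ := by
  refine unordered_pair_mem_hereditarySets hθ ?_ (unordered_pair_mem_hereditarySets hθ hx hy)
  simpa using unordered_pair_mem_hereditarySets hθ hx hx

theorem IsFirstOrder.pair_mem_hereditarySets (hθ : θ.IsRegular) {α : Type} (a b c : α) :
    IsFirstOrder fun v : α → hereditarySets θ => ZFSet.pair (v a) (v b) ∈ (v c : ZFSet) :=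
  .pair_mem (fun _ hx _ hy => mem_hereditarySets_of_mem hx hy)
    (fun _ hx _ hy => unordered_pair_mem_hereditarySets hθ hx hy) a b c

end Hereditary

/-- The graph of a function between two sets. -/
noncomputable def ZFSet.graph {a b : ZFSet.{u}} (h : a → b) : ZFSet.{u} :=
  (a.prod b).sep fun p => ∃ i : a, p = ZFSet.pair i (h i)

theorem ZFSet.pair_mem_graph {a b : ZFSet.{u}} {h : a → b} {x y : ZFSet.{u}} :
    ZFSet.pair x y ∈ ZFSet.graph h ↔ ∃ hx : x ∈ a, h ⟨x, hx⟩ = y := by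
  rw [ZFSet.graph, ZFSet.mem_sep]
  constructor
  · rintro ⟨-, i, hi⟩
    obtain ⟨rfl, rfl⟩ := ZFSet.pair_injective hi
    exact ⟨i.2, rfl⟩
  · rintro ⟨hx, rfl⟩
    exact ⟨ZFSet.pair_mem_prod.2 ⟨hx, (h _).2⟩, _, rfl⟩

theorem ZFSet.isFunc_graph {a b : ZFSet.{u}} (h : a → b) : ZFSet.IsFunc a b (ZFSet.graph h) := by
  refine ⟨ZFSet.sep_subset, fun z hz => ⟨h ⟨z, hz⟩, ZFSet.pair_mem_graph.2 ⟨hz, rfl⟩, ?_⟩⟩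
  intro w hw
  exact (ZFSet.pair_mem_graph.1 hw).2.symm

theorem ZFSet.graph_mem_hereditarySets {θ : Cardinal.{u}} (hθ : θ.IsRegular) {a b : ZFSet.{u}}
    (ha : a ∈ hereditarySets θ) (hb : b ∈ hereditarySets θ) (h : a → b) :
    ZFSet.graph h ∈ hereditarySets θ := by
  refine mem_hereditarySets_of_card_lt hθ ?_ fun p hp => ?_
  · refine lt_of_le_of_lt ?_ (card_lt_of_mem_hereditarySets ha)
    rw [← Cardinal.lift_le.{u + 1}, ← ZFSet.cardinalMk_coe_sort, ← ZFSet.cardinalMk_coe_sort]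
    refine Cardinal.mk_le_of_surjective
      (f := fun i : a => ⟨ZFSet.pair i (h i), ZFSet.pair_mem_graph.2 ⟨i.2, rfl⟩⟩) ?_
    rintro ⟨p, hp⟩
    obtain ⟨-, i, rfl⟩ := ZFSet.mem_sep.1 hp
    exact ⟨i, rfl⟩
  · obtain ⟨-, i, rfl⟩ := ZFSet.mem_sep.1 hp
    exact pair_mem_hereditarySets hθ (mem_hereditarySets_of_mem ha i.2)
      (mem_hereditarySets_of_mem hb (h i).2)

/-! ### Free sequences -/

section Topological

variable {X : Type v} [TopologicalSpace X]

theorem IsFreeSet.mono {D E : Set X} (hE : IsFreeSet E) (h : D ⊆ E) : IsFreeSet D := by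
  obtain ⟨r, hr, hf⟩ := hE
  let e : D ↪ E := ⟨Set.inclusion h, Set.inclusion_injective h⟩
  refine ⟨e ⁻¹'o r, (RelEmbedding.preimage e r).isWellOrder, fun b => ?_⟩
  refine (hf (e b)).mono (closure_mono ?_) (closure_mono ?_)
  · rintro _ ⟨a, ha, rfl⟩
    exact ⟨e a, ha, rfl⟩
  · rintro _ ⟨a, ha, rfl⟩
    exact ⟨e a, ha, rfl⟩

/-- Subsets of free sets are free, so the sizes of free sets are downward closed. The size `succ #X`
is never attained, so the infimum is not that of an empty set. -/
theorem card_lt_freenessHat {D : Set X} (hD : IsFreeSet D) : #D < freenessHat X := by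
  have hne : {c | ¬ ∃ D : Set X, IsFreeSet D ∧ #D = c}.Nonempty :=
    ⟨Order.succ #X, fun ⟨E, _, hE⟩ =>
      (Order.lt_succ #X).not_ge (hE ▸ Cardinal.mk_set_le E)⟩
  refine lt_of_not_ge fun hle => csInf_mem hne ?_
  obtain ⟨E, hED, hE⟩ := Cardinal.le_mk_iff_exists_subset.1 hle
  exact ⟨E, hD.mono hED, hE⟩

/-- A sequence whose proper initial segments have closures that open sets separate from the
remaining terms is injective, and its range is free. -/
theorem injective_and_isFreeSet_range {ι : Type v} [LinearOrder ι] [WellFoundedLT ι] {x : ι → X}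
    {U : ι → Set X} (hU : ∀ i, IsOpen (U i)) (hsub : ∀ i, closure (x '' Set.Iio i) ⊆ U i)
    (hx : ∀ i j, i ≤ j → x j ∉ U i) : x.Injective ∧ IsFreeSet (Set.range x) := by
  have hinj : x.Injective := by
    intro i j hij
    rcases lt_trichotomy i j with h | h | h
    · exact (hx j j le_rfl (hij ▸ hsub j (subset_closure ⟨i, h, rfl⟩))).elim
    · exact h
    · exact (hx i i le_rfl (hij ▸ hsub i (subset_closure ⟨j, h, rfl⟩))).elim
  let e := (Equiv.ofInjective x hinj).symm
  refine ⟨hinj, e ⁻¹'o (· < ·), (RelIso.preimage e (· < ·)).toRelEmbedding.isWellOrder, fun b => ?_⟩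
  have he : ∀ d, x (e d) = d := Equiv.apply_ofInjective_symm hinj
  -- The complement of `U (e b)` is closed and contains the tail, hence its closure.
  refine Set.disjoint_of_subset ((closure_mono ?_).trans (hsub (e b)))
    (closure_minimal (t := (U (e b))ᶜ) ?_ (hU _).isClosed_compl) disjoint_compl_right
  · rintro _ ⟨a, ha, rfl⟩
    exact ⟨e a, ha, he a⟩
  · rintro _ ⟨a, ha, rfl⟩
    change (a : X) ∈ _
    rw [← he a]
    exact hx _ _ (not_lt.1 ha)

/-- In a `T1` space `A` is the intersection of the complements of the points outside it, so the
infimum is attained. -/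
theorem exists_sInter_eq_of_pseudocharacter_le [T1Space X] (A : Set X) :
    ∃ V : Set (Set X), (∀ U ∈ V, IsOpen U) ∧ ⋂₀ V = A ∧ #V = pseudocharacter A := by
  have hne : {c | ∃ V : Set (Set X), (∀ U ∈ V, IsOpen U) ∧ ⋂₀ V = A ∧ #V = c}.Nonempty := by
    refine ⟨_, (fun x => {x}ᶜ) '' Aᶜ, ?_, ?_, rfl⟩
    · rintro _ ⟨x, -, rfl⟩
      exact isOpen_compl_singleton
    · ext y
      simp only [Set.mem_sInter, Set.forall_mem_image, Set.mem_compl_iff, Set.mem_singleton_iff]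
      exact ⟨fun h => by_contra fun hy => h hy rfl, fun hy x hx hxy => hx (hxy ▸ hy)⟩
  exact csInf_mem hne

end Topological

/-! ### Subsets of a set of sets, as sets -/

/-- A subset of the type of elements of `X`, as a set. -/
noncomputable def ZFSet.ofSubset {X : ZFSet.{u}} (A : Set X) : ZFSet.{u} :=
  X.sep fun x => ∃ h : x ∈ X, (⟨x, h⟩ : X) ∈ A

namespace ZFSet

variable {X : ZFSet.{u}} {A B : Set X}

theorem mem_ofSubset {x : ZFSet.{u}} : x ∈ ofSubset A ↔ ∃ h : x ∈ X, (⟨x, h⟩ : X) ∈ A := by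
  rw [ofSubset, mem_sep]
  exact ⟨fun h => h.2, fun h => ⟨h.1, h⟩⟩

@[simp]
theorem coe_mem_ofSubset {x : X} : (x : ZFSet.{u}) ∈ ofSubset A ↔ x ∈ A :=
  mem_ofSubset.trans ⟨fun h => h.2, fun h => ⟨x.2, h⟩⟩

theorem ofSubset_subset : ofSubset A ⊆ X := sep_subset

theorem ofSubset_injective : Function.Injective (ofSubset (X := X)) := fun A B h =>
  Set.ext fun x => by rw [← coe_mem_ofSubset, h, coe_mem_ofSubset]

theorem lift_card_ofSubset : lift.{u + 1} (ofSubset A).card = #A := by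
  rw [← cardinalMk_coe_sort]
  refine Cardinal.mk_congr ⟨fun x => ⟨⟨x, ofSubset_subset x.2⟩, coe_mem_ofSubset.1 x.2⟩,
    fun x => ⟨x.1, coe_mem_ofSubset.2 x.2⟩, fun _ => rfl, fun _ => rfl⟩

theorem exists_eq_ofSubset {U : ZFSet.{u}} (h : U ⊆ X) :
    U = ofSubset {x : X | (x : ZFSet.{u}) ∈ U} := by
  ext x
  rw [mem_ofSubset]
  exact ⟨fun hx => ⟨h hx, hx⟩, fun ⟨_, hx⟩ => hx⟩

theorem mem_topologySet [TopologicalSpace X] {U : ZFSet.{u}} :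
    U ∈ topologySet X ↔ ∃ A : Set X, IsOpen A ∧ U = ofSubset A := by
  rw [topologySet, mem_sep, mem_powerset]
  constructor
  · exact fun ⟨h, ho⟩ => ⟨_, ho, exists_eq_ofSubset h⟩
  · rintro ⟨A, hA, rfl⟩
    exact ⟨ofSubset_subset, by simpa using hA⟩

@[simp]
theorem ofSubset_mem_topologySet [TopologicalSpace X] : ofSubset A ∈ topologySet X ↔ IsOpen A :=
  mem_topologySet.trans
    ⟨fun ⟨_, hB, h⟩ => ofSubset_injective h ▸ hB, fun h => ⟨A, h, rfl⟩⟩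

end ZFSet

/-! ### Elements of elementary submodels -/

section Submodel

variable {θ κ : Cardinal.{u}} {M : ZFSet.{u}}

theorem hereditarySets_ext {x y : ZFSet.{u}} (hx : x ∈ hereditarySets θ)
    (hy : y ∈ hereditarySets θ) (h : ∀ z : hereditarySets θ, z.1 ∈ x ↔ z.1 ∈ y) : x = y :=
  ZFSet.ext fun z => ⟨fun hz => (h ⟨z, mem_hereditarySets_of_mem hx hz⟩).1 hz,
    fun hz => (h ⟨z, mem_hereditarySets_of_mem hy hz⟩).2 hz⟩

/-- A set that is first-order definable from elements of an elementary submodel belongs to it. -/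
theorem IsElementarySubmodel.mem_of_forall_mem_iff
    (hM : IsElementarySubmodel M (hereditarySets θ)) {α : Type}
    {P : (α → hereditarySets θ) → hereditarySets θ → Prop}
    (hP : IsFirstOrder fun w : Option α → hereditarySets θ => P (fun j => w (some j)) (w none))
    (v : α → hereditarySets θ) (hv : ∀ i, (v i : ZFSet) ∈ M) {Z : ZFSet.{u}}
    (hZ : Z ∈ hereditarySets θ) (h : ∀ z : hereditarySets θ, z.1 ∈ Z ↔ P v z) : Z ∈ M := by
  have hQ : IsFirstOrder fun w : Option α → hereditarySets θ =>
      ∀ z : hereditarySets θ, z.1 ∈ (w none).1 ↔ P (fun j => w (some j)) z := by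
    refine .all (.iff (.mem none (some none)) ?_)
    obtain ⟨φ, hφ⟩ := hP
    exact ⟨φ.relabel (fun o => o.elim none fun j => some (some j)), fun w => by
      rw [Language.Formula.realize_relabel, hφ]; rfl⟩
  obtain ⟨x, hxM, hx⟩ := hM.exists_mem
    (P := fun v x => ∀ z : hereditarySets θ, z.1 ∈ x.1 ↔ P v z) hQ v hv ⟨⟨Z, hZ⟩, h⟩
  rwa [hereditarySets_ext hZ x.2 fun z => (h z).trans (hx z).symm]

theorem IsElementarySubmodel.mem_of_pair_mem (hθ : θ.IsRegular)
    (hM : IsElementarySubmodel M (hereditarySets θ)) {x y : ZFSet.{u}} (h : ZFSet.pair x y ∈ M) :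
    x ∈ M ∧ y ∈ M := by
  have hp := hM.subset h
  have hxy : ({x, y} : ZFSet) ∈ hereditarySets θ :=
    mem_hereditarySets_of_mem hp (ZFSet.mem_pair.2 (.inr rfl))
  have hx := mem_hereditarySets_of_mem hxy (ZFSet.mem_pair.2 (.inl rfl))
  have hy := mem_hereditarySets_of_mem hxy (ZFSet.mem_pair.2 (.inr rfl))
  -- The available formula says that a pair belongs to a set, so the pair is replaced by its
  -- singleton.
  have hs : ({ZFSet.pair x y} : ZFSet) ∈ hereditarySets θ := by
    simpa using unordered_pair_mem_hereditarySets hθ hp hp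
  have hsM : ({ZFSet.pair x y} : ZFSet) ∈ M :=
    hM.mem_of_forall_mem_iff (P := fun (v : Unit → hereditarySets θ) z => z = v ())
      (.eq none (some ())) (fun _ => ⟨_, hp⟩) (fun _ => h) hs fun z => by
        rw [ZFSet.mem_singleton, Subtype.ext_iff]
  obtain ⟨a, haM, b, hab⟩ := hM.exists_mem
    (P := fun (v : Unit → hereditarySets θ) a => ∃ b : hereditarySets θ, ZFSet.pair a b ∈ (v ()).1)
    (.ex (.pair_mem_hereditarySets hθ (some none) none (some (some ()))))
    (fun _ => ⟨_, hs⟩) (fun _ => hsM) ⟨⟨x, hx⟩, ⟨y, hy⟩, ZFSet.mem_singleton.2 rfl⟩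
  obtain ⟨c, hcM, d, hdc⟩ := hM.exists_mem
    (P := fun (v : Unit → hereditarySets θ) a => ∃ b : hereditarySets θ, ZFSet.pair b a ∈ (v ()).1)
    (.ex (.pair_mem_hereditarySets hθ none (some none) (some (some ()))))
    (fun _ => ⟨_, hs⟩) (fun _ => hsM) ⟨⟨y, hy⟩, ⟨x, hx⟩, ZFSet.mem_singleton.2 rfl⟩
  obtain ⟨rfl, -⟩ := ZFSet.pair_injective (ZFSet.mem_singleton.1 hab)
  obtain ⟨-, rfl⟩ := ZFSet.pair_injective (ZFSet.mem_singleton.1 hdc)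
  exact ⟨haM, hcM⟩

/-- An enumeration of `Z` by its cardinal is in `M` by closure, and `Z` is definable as its range.
-/
theorem IsElementarySubmodel.mem_of_subset_of_card_lt (hθ : θ.IsRegular)
    (hM : IsElementarySubmodel M (hereditarySets θ)) (hclosed : IsLTClosed κ M) {Z : ZFSet.{u}}
    (hZ : Z ∈ hereditarySets θ) (hZM : Z ⊆ M) (hcard : Z.card < κ) : Z ∈ M := by
  obtain ⟨e⟩ : Nonempty (Z.card.ord.toZFSet ≃ Z) := by
    rw [← Cardinal.eq, ZFSet.cardinalMk_coe_sort, ZFSet.cardinalMk_coe_sort, Ordinal.card_toZFSet,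
      Cardinal.card_ord]
  let h : Z.card.ord.toZFSet → M := fun i => ⟨e i, hZM (e i).2⟩
  have hf : ZFSet.graph h ∈ M := hclosed _ hcard _ (ZFSet.isFunc_graph h)
  have hfH := hM.subset hf
  refine hM.mem_of_forall_mem_iff
    (P := fun (v : Unit → hereditarySets θ) z => ∃ w : hereditarySets θ, ZFSet.pair w z ∈ (v ()).1)
    (.ex (.pair_mem_hereditarySets hθ none (some none) (some (some ()))))
    (fun _ => ⟨_, hfH⟩) (fun _ => hf) hZ fun z => ⟨fun hz => ?_, ?_⟩
  · have hw : ZFSet.pair (e.symm ⟨z, hz⟩) z ∈ ZFSet.graph h :=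
      ZFSet.pair_mem_graph.2 ⟨(e.symm ⟨z, hz⟩).2, by simp [h]⟩
    have hs := mem_hereditarySets_of_mem (mem_hereditarySets_of_mem hfH hw)
      (ZFSet.mem_pair.2 (.inl rfl))
    exact ⟨⟨_, mem_hereditarySets_of_mem hs (ZFSet.mem_singleton.2 rfl)⟩, hw⟩
  · rintro ⟨w, hw⟩
    obtain ⟨hw, hz⟩ := ZFSet.pair_mem_graph.1 hw
    exact hz ▸ (e _).2

variable {X : ZFSet.{u}} [TopologicalSpace X]

/-- The closure is definable from `X`, its topology and `A`, all in `M`; the quantifiers only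
concern open sets and points, which lie in `H(θ)`. -/
theorem IsElementarySubmodel.ofSubset_closure_mem
    (hM : IsElementarySubmodel M (hereditarySets θ)) (hXM : X ∈ M) (hτM : topologySet X ∈ M)
    {A : Set X} (hA : ZFSet.ofSubset A ∈ M) : ZFSet.ofSubset (closure A) ∈ M := by
  have hXH := hM.subset hXM
  have hτH := hM.subset hτM
  have hP : IsFirstOrder fun w : Option (Fin 3) → hereditarySets θ =>
      (w none).1 ∈ (w (some 0)).1 ∧ ∀ W : hereditarySets θ, W.1 ∈ (w (some 1)).1 →
        (w none).1 ∈ W.1 → ∃ d : hereditarySets θ, d.1 ∈ (w (some 2)).1 ∧ d.1 ∈ W.1 :=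
    .and (.mem none (some 0)) (.all (.imp (.mem none (some (some 1)))
      (.imp (.mem (some none) none) (.ex
        (.and (.mem none (some (some (some 2)))) (.mem none (some none)))))))
  refine hM.mem_of_forall_mem_iff (P := fun v z => z.1 ∈ (v 0).1 ∧
      ∀ W : hereditarySets θ, W.1 ∈ (v 1).1 → z.1 ∈ W.1 →
        ∃ d : hereditarySets θ, d.1 ∈ (v 2).1 ∧ d.1 ∈ W.1) hP
    ![⟨X, hXH⟩, ⟨_, hτH⟩, ⟨_, hM.subset hA⟩] (by simp [Fin.forall_fin_succ, *])
    (mem_hereditarySets_of_subset hXH ZFSet.ofSubset_subset) ?_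
  rintro ⟨z, hz⟩
  change z ∈ ZFSet.ofSubset (closure A) ↔ z ∈ X ∧ ∀ W : hereditarySets θ, W.1 ∈ topologySet X →
    z ∈ W.1 → ∃ d : hereditarySets θ, d.1 ∈ ZFSet.ofSubset A ∧ d.1 ∈ W.1
  rw [ZFSet.mem_ofSubset, ← exists_prop]
  refine exists_congr fun hzX => ?_
  rw [mem_closure_iff]
  constructor
  · rintro h ⟨W, hW⟩ hWτ hzW
    obtain ⟨B, hB, rfl⟩ := ZFSet.mem_topologySet.1 hWτ
    obtain ⟨d, hdB, hdA⟩ := h B hB (ZFSet.coe_mem_ofSubset (x := ⟨z, hzX⟩).1 hzW)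
    exact ⟨⟨d, mem_hereditarySets_of_mem hXH d.2⟩, ZFSet.coe_mem_ofSubset.2 hdA,
      ZFSet.coe_mem_ofSubset.2 hdB⟩
  · intro h B hB hzB
    have hBτ := ZFSet.ofSubset_mem_topologySet.2 hB
    obtain ⟨d, hdA, hdB⟩ := h ⟨_, mem_hereditarySets_of_mem hτH hBτ⟩ hBτ
      (ZFSet.coe_mem_ofSubset (x := ⟨z, hzX⟩).2 hzB)
    obtain ⟨hd, hdA⟩ := ZFSet.mem_ofSubset.1 hdA
    exact ⟨⟨d, hd⟩, ZFSet.coe_mem_ofSubset (x := ⟨d, hd⟩).1 hdB, hdA⟩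

/-- If `C` is the intersection of a family of open sets indexed by a subset of the elementary
submodel `M`, then the open sets in `M` that include `C` separate `C` from each point. -/
theorem IsElementarySubmodel.exists_isOpen_superset (hθ : θ.IsRegular)
    (hM : IsElementarySubmodel M (hereditarySets θ)) (hXM : X ∈ M) (hτM : topologySet X ∈ M)
    {I : ZFSet.{u}} (hI : I ∈ M) (hIM : I ⊆ M) {C : Set X} (hC : ZFSet.ofSubset C ∈ M)
    {V : Set (Set X)} (hVo : ∀ U ∈ V, IsOpen U) (hVC : ⋂₀ V = C)
    (hV : #V ≤ lift.{u + 1} I.card) {p : X} (hp : p ∉ C) :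
    ∃ U : Set X, IsOpen U ∧ C ⊆ U ∧ p ∉ U ∧ ZFSet.ofSubset U ∈ M := by
  have hXH := hM.subset hXM
  have hτH := hM.subset hτM
  have hIH := hM.subset hI
  -- An empty `V` has intersection `univ`, which contains `p`; nonemptiness lets `I` enumerate `V`.
  have hVne : Nonempty V := by
    by_contra hne
    rw [Set.nonempty_coe_sort, Set.not_nonempty_iff_eq_empty] at hne
    subst hne
    simp [← hVC] at hp
  obtain ⟨e, he⟩ : ∃ e : I → V, e.Surjective := by
    rw [← ZFSet.cardinalMk_coe_sort] at hV
    obtain ⟨f⟩ := hV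
    exact ⟨_, Function.invFun_surjective f.injective⟩
  let h : I → topologySet X := fun i =>
    ⟨ZFSet.ofSubset (e i).1, ZFSet.ofSubset_mem_topologySet.2 (hVo _ (e i).2)⟩
  have hP : IsFirstOrder fun w : Option (Fin 4) → hereditarySets θ =>
      (∀ i U U' : hereditarySets θ, ZFSet.pair i U ∈ (w none).1 → ZFSet.pair i U' ∈ (w none).1 →
        U = U') ∧
      (∀ i U : hereditarySets θ, ZFSet.pair i U ∈ (w none).1 → U.1 ∈ (w (some 1)).1 ∧
        ∀ y : hereditarySets θ, y.1 ∈ (w (some 2)).1 → y.1 ∈ U.1) ∧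
      ∀ y : hereditarySets θ, y.1 ∈ (w (some 0)).1 → ¬ y.1 ∈ (w (some 2)).1 →
        ∃ i U : hereditarySets θ, i.1 ∈ (w (some 3)).1 ∧ ZFSet.pair i U ∈ (w none).1 ∧
          ¬ y.1 ∈ U.1 := by
    refine .and (.all (.all (.all ?_))) (.and (.all (.all ?_)) (.all ?_))
    · exact .imp (.pair_mem_hereditarySets hθ (some (some none)) (some none)
        (some (some (some none)))) (.imp (.pair_mem_hereditarySets hθ (some (some none)) none
        (some (some (some none)))) (.eq (some none) none))
    · exact .imp (.pair_mem_hereditarySets hθ (some none) none (some (some none)))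
        (.and (.mem none (some (some (some 1)))) (.all (.imp
          (.mem none (some (some (some (some 2))))) (.mem none (some none)))))
    · exact .imp (.mem none (some (some 0))) (.imp (.not (.mem none (some (some 2))))
        (.ex (.ex (.and (.mem (some none) (some (some (some (some 3)))))
          (.and (.pair_mem_hereditarySets hθ (some none) none (some (some (some none))))
            (.not (.mem (some (some none)) none)))))))
  obtain ⟨g, hgM, hgf, hgτ, hgC⟩ := hM.exists_mem (P := fun v g =>
      (∀ i U U' : hereditarySets θ, ZFSet.pair i U ∈ g.1 → ZFSet.pair i U' ∈ g.1 → U = U') ∧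
      (∀ i U : hereditarySets θ, ZFSet.pair i U ∈ g.1 → U.1 ∈ (v 1).1 ∧
        ∀ y : hereditarySets θ, y.1 ∈ (v 2).1 → y.1 ∈ U.1) ∧
      ∀ y : hereditarySets θ, y.1 ∈ (v 0).1 → ¬ y.1 ∈ (v 2).1 →
        ∃ i U : hereditarySets θ, i.1 ∈ (v 3).1 ∧ ZFSet.pair i U ∈ g.1 ∧ ¬ y.1 ∈ U.1) hP
    ![⟨X, hXH⟩, ⟨_, hτH⟩, ⟨_, hM.subset hC⟩, ⟨I, hIH⟩] (by simp [Fin.forall_fin_succ, *])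
    ⟨⟨_, ZFSet.graph_mem_hereditarySets hθ hIH hτH h⟩, by
      refine ⟨fun i U U' hU hU' => ?_, fun i U hU => ?_, fun y hyX hyC => ?_⟩
      · obtain ⟨hi, hU⟩ := ZFSet.pair_mem_graph.1 hU
        obtain ⟨hi, hU'⟩ := ZFSet.pair_mem_graph.1 hU'
        exact Subtype.ext (hU.symm.trans hU')
      · obtain ⟨hi, hU⟩ := ZFSet.pair_mem_graph.1 hU
        refine ⟨hU ▸ (h _).2, fun y hy => hU ▸ ?_⟩
        obtain ⟨hyX, hyC⟩ := ZFSet.mem_ofSubset.1 hy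
        refine ZFSet.mem_ofSubset.2 ⟨hyX, ?_⟩
        rw [← hVC] at hyC
        exact hyC _ (e _).2
      · have hy : (⟨y, hyX⟩ : X) ∉ ⋂₀ V := fun hy =>
          hyC (ZFSet.mem_ofSubset.2 ⟨hyX, hVC ▸ hy⟩)
        rw [Set.mem_sInter] at hy
        push Not at hy
        obtain ⟨U, hUV, hyU⟩ := hy
        obtain ⟨i, hi⟩ := he ⟨U, hUV⟩
        refine ⟨⟨i, mem_hereditarySets_of_mem hIH i.2⟩,
          ⟨h i, mem_hereditarySets_of_mem hτH (h i).2⟩, i.2,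
          ZFSet.pair_mem_graph.2 ⟨i.2, rfl⟩, fun hyi => hyU ?_⟩
        have hyi : (⟨y, hyX⟩ : X) ∈ (e i).1 := (ZFSet.mem_ofSubset.1 hyi).2
        rwa [hi] at hyi⟩
  obtain ⟨i, U, hiI, hiU, hpU⟩ := hgC ⟨p, mem_hereditarySets_of_mem hXH p.2⟩ p.2
    fun h => hp (ZFSet.coe_mem_ofSubset.1 h)
  -- As `i ∈ I ⊆ M` and `g ∈ M`, some value of `g` at `i` lies in `M`; `g` is single-valued, so it
  -- is `U`.
  obtain ⟨U', hU'M, hiU'⟩ := hM.exists_mem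
    (P := fun (v : Fin 2 → hereditarySets θ) U => ZFSet.pair (v 0) U ∈ (v 1).1)
    (.pair_mem_hereditarySets hθ (some 0) none (some 1)) ![i, g]
    (by simpa [Fin.forall_fin_succ] using ⟨hIM hiI, hgM⟩) ⟨U, hiU⟩
  obtain rfl : U = U' := hgf i U U' hiU hiU'
  obtain ⟨hUτ, hUC⟩ := hgτ i U hiU
  obtain ⟨B, hB, hUB⟩ := ZFSet.mem_topologySet.1 hUτ
  rw [hUB] at hU'M hpU hUC
  refine ⟨B, hB, fun y hy => ?_, fun h => hpU (ZFSet.coe_mem_ofSubset.2 h), hU'M⟩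
  exact ZFSet.coe_mem_ofSubset.1 (hUC ⟨y, mem_hereditarySets_of_mem hXH y.2⟩
    (ZFSet.coe_mem_ofSubset.2 hy))

/-- If fewer than `κ` sets in a `<κ`-closed elementary submodel do not cover the space, together
with one more set in it, then they do not cover the points in the submodel. -/
theorem IsElementarySubmodel.exists_notMem (hθ : θ.IsRegular)
    (hM : IsElementarySubmodel M (hereditarySets θ)) (hclosed : IsLTClosed κ M) (hXM : X ∈ M)
    (hτM : topologySet X ∈ M) {W : Set (Set X)} (hWo : ∀ U ∈ W, IsOpen U)
    (hWM : ∀ U ∈ W, ZFSet.ofSubset U ∈ M) (hWc : #W < lift.{u + 1} κ) {U : Set X}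
    (hU : ZFSet.ofSubset U ∈ M) {p : X} (hpW : ∀ U ∈ W, p ∉ U) (hpU : p ∉ U) :
    ∃ x : X, (x : ZFSet) ∈ M ∧ x ∉ U ∧ ∀ U ∈ W, x ∉ U := by
  have hXH := hM.subset hXM
  have hτH := hM.subset hτM
  let Z : ZFSet.{u} := (topologySet X).sep fun B => ∃ U ∈ W, B = ZFSet.ofSubset U
  have hmem : ∀ {B}, B ∈ Z ↔ ∃ U ∈ W, B = ZFSet.ofSubset U := fun {B} => by
    refine ZFSet.mem_sep.trans (and_iff_right_of_imp ?_)
    rintro ⟨U, hU, rfl⟩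
    exact ZFSet.ofSubset_mem_topologySet.2 (hWo U hU)
  have hZ : Z ∈ M := by
    refine hM.mem_of_subset_of_card_lt hθ hclosed
      (mem_hereditarySets_of_subset hτH ZFSet.sep_subset) (fun B hB => ?_) ?_
    · obtain ⟨U, hU, rfl⟩ := hmem.1 hB
      exact hWM U hU
    · rw [← Cardinal.lift_lt.{u, u + 1}, ← ZFSet.cardinalMk_coe_sort]
      refine (Cardinal.mk_le_of_surjective
        (f := fun U : W => (⟨_, hmem.2 ⟨U, U.2, rfl⟩⟩ : Z)) ?_).trans_lt hWc
      rintro ⟨B, hB⟩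
      obtain ⟨U, hU, rfl⟩ := hmem.1 hB
      exact ⟨⟨U, hU⟩, rfl⟩
  have hP : IsFirstOrder fun w : Option (Fin 3) → hereditarySets θ =>
      (w none).1 ∈ (w (some 0)).1 ∧ ¬ (w none).1 ∈ (w (some 1)).1 ∧
        ∀ B : hereditarySets θ, B.1 ∈ (w (some 2)).1 → ¬ (w none).1 ∈ B.1 :=
    .and (.mem none (some 0)) (.and (.not (.mem none (some 1)))
      (.all (.imp (.mem none (some (some 2))) (.not (.mem (some none) none)))))
  obtain ⟨x, hxM, hxX, hxU, hxW⟩ := hM.exists_mem (P := fun v x =>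
      x.1 ∈ (v 0).1 ∧ ¬ x.1 ∈ (v 1).1 ∧
        ∀ B : hereditarySets θ, B.1 ∈ (v 2).1 → ¬ x.1 ∈ B.1) hP
    ![⟨X, hXH⟩, ⟨_, hM.subset hU⟩, ⟨Z, hM.subset hZ⟩] (by simp [Fin.forall_fin_succ, *])
    ⟨⟨p, mem_hereditarySets_of_mem hXH p.2⟩, p.2, fun h => hpU (ZFSet.coe_mem_ofSubset.1 h), by
      rintro ⟨B, hBH⟩ hB hpB
      obtain ⟨U, hU, rfl⟩ := hmem.1 hB
      exact hpW U hU (ZFSet.coe_mem_ofSubset.1 hpB)⟩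
  refine ⟨⟨x, hxX⟩, hxM, fun h => hxU (ZFSet.mem_ofSubset.2 ⟨hxX, h⟩), fun B hB hxB => ?_⟩
  have hBZ := hmem.2 ⟨B, hB, rfl⟩
  exact hxW ⟨_, mem_hereditarySets_of_mem (hM.subset hZ) hBZ⟩ hBZ
    (ZFSet.mem_ofSubset.2 ⟨hxX, hxB⟩)

end Submodel

theorem theorem1 (X : ZFSet.{u}) [TopologicalSpace X] [T1Space X] (κ θ : Cardinal.{u})
    (hθ : θ.IsRegular) (hθ' : ℵ₀ < θ) (M : ZFSet.{u})
    (hM : IsElementarySubmodel M (hereditarySets θ)) (hclosed : IsLTClosed κ M)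
    (hX : spaceSet X ∈ M) (hμ : (M.card.ord + 1).toZFSet ⊆ M)
    (hψ : ∀ D ∈ smallFreeSets X κ M, pseudocharacter (closure D) ≤ lift.{u + 1} M.card) :
    (⋃ D ∈ smallFreeSets X κ M, closure D) = Set.univ ∨
      (lift.{u + 1} κ < freenessHat X ∧ ∃ D : Set X, IsFreeSet D ∧ #D = lift.{u + 1} κ) := by
  obtain ⟨hXM, hτM⟩ := hM.mem_of_pair_mem hθ hX
  -- The index set is `μ` itself: `μ + 1 ⊆ M` gives both `μ ∈ M` and `μ ⊆ M`.
  have hIM : M.card.ord.toZFSet ∈ M := hμ (by rw [Ordinal.toZFSet_add_one]; simp)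
  have hIsub : M.card.ord.toZFSet ⊆ M := fun i hi => hμ (by
    rw [Ordinal.toZFSet_add_one]; exact ZFSet.mem_insert_of_mem _ hi)
  refine or_iff_not_imp_left.2 fun hne => ?_
  obtain ⟨p, hp⟩ := (Set.ne_univ_iff_exists_notMem _).1 hne
  simp only [Set.mem_iUnion, not_exists] at hp
  have step : ∀ (D : Set X) (W : Set (Set X)), D ∈ smallFreeSets X κ M →
      (∀ U ∈ W, IsOpen U ∧ p ∉ U ∧ ZFSet.ofSubset U ∈ M) → #W < lift.{u + 1} κ →
      ∃ q : X × Set X, (IsOpen q.2 ∧ p ∉ q.2 ∧ ZFSet.ofSubset q.2 ∈ M) ∧ closure D ⊆ q.2 ∧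
        (q.1 : ZFSet) ∈ M ∧ q.1 ∉ q.2 ∧ ∀ U ∈ W, q.1 ∉ U := by
    intro D W hD hW hWc
    have hDM : ZFSet.ofSubset D ∈ M := by
      refine hM.mem_of_subset_of_card_lt hθ hclosed
        (mem_hereditarySets_of_subset (hM.subset hXM) ZFSet.ofSubset_subset) (fun x hx => ?_) ?_
      · obtain ⟨hxX, hxD⟩ := ZFSet.mem_ofSubset.1 hx
        exact hD.2.1 _ hxD
      · rw [← Cardinal.lift_lt.{u, u + 1}, ZFSet.lift_card_ofSubset]
        exact hD.2.2
    obtain ⟨V, hVo, hVD, hVc⟩ := exists_sInter_eq_of_pseudocharacter_le (closure D)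
    obtain ⟨U, hUo, hDU, hpU, hUM⟩ := hM.exists_isOpen_superset hθ hXM hτM hIM hIsub
      (hM.ofSubset_closure_mem hXM hτM hDM) hVo hVD
      (by rw [hVc, Ordinal.card_toZFSet, Cardinal.card_ord]; exact hψ D hD) (hp D hD)
    obtain ⟨x, hxM, hxU, hxW⟩ := hM.exists_notMem hθ hclosed hXM hτM (fun U hU => (hW U hU).1)
      (fun U hU => (hW U hU).2.2) hWc hUM (fun U hU => (hW U hU).2.1) hpU
    exact ⟨(x, U), ⟨hUo, hpU, hUM⟩, hDU, hxM, hxU, hxW⟩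
  let Good (D : Set X) (W : Set (Set X)) (q : X × Set X) : Prop :=
    (IsOpen q.2 ∧ p ∉ q.2 ∧ ZFSet.ofSubset q.2 ∈ M) ∧ closure D ⊆ q.2 ∧
      (q.1 : ZFSet) ∈ M ∧ q.1 ∉ q.2 ∧ ∀ U ∈ W, q.1 ∉ U
  let ι : Type (u + 1) := Set.Iio κ.ord
  have hι : #ι = lift.{u + 1} κ := by
    rw [Cardinal.mk_Iio_ordinal, Cardinal.card_ord]
  have hIio : ∀ α : ι, #(Set.Iio α) < lift.{u + 1} κ := by
    intro α
    have h : #(Set.Iio α) ≤ #(Set.Iio α.1) :=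
      Cardinal.mk_le_of_injective (f := fun β => (⟨β.1.1, β.2⟩ : Set.Iio α.1))
        fun β γ h => Subtype.ext (Subtype.ext (congrArg (fun x : Set.Iio α.1 => x.1) h))
    refine h.trans_lt ?_
    rw [Cardinal.mk_Iio_ordinal, Cardinal.lift_lt]
    exact Cardinal.lt_ord.1 α.2
  have : Nonempty (X × Set X) := ⟨(p, ∅)⟩
  -- Choosing by `epsilon` keeps the recursion free of proof obligations; that each choice is good
  -- is shown afterwards by induction.
  obtain ⟨q, hq⟩ : ∃ q : ι → X × Set X, ∀ α, q α = Classical.epsilon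
      (Good ((fun β => (q β).1) '' Set.Iio α) ((fun β => (q β).2) '' Set.Iio α)) := by
    let F : ∀ α : ι, (∀ β, β < α → X × Set X) → X × Set X := fun α f => Classical.epsilon
      (Good (Set.range fun β : Set.Iio α => (f β.1 β.2).1)
        (Set.range fun β : Set.Iio α => (f β.1 β.2).2))
    refine ⟨wellFounded_lt.fix F, fun α => ?_⟩
    rw [wellFounded_lt.fix_eq, Set.image_eq_range, Set.image_eq_range]
  have hgood : ∀ α,
      Good ((fun β => (q β).1) '' Set.Iio α) ((fun β => (q β).2) '' Set.Iio α) (q α) := by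
    intro α
    induction α using WellFoundedLT.induction with
    | ind α ih =>
      rw [hq α]
      refine Classical.epsilon_spec (step _ _ ⟨?_, ?_, ?_⟩ ?_ ?_)
      -- The initial segment is free by the same separation criterion as the full sequence, applied
      -- to the stages below `α`.
      · rw [Set.image_eq_range]
        refine (injective_and_isFreeSet_range (x := fun β : Set.Iio α => (q β).1)
          (U := fun β => (q β).2) (fun β => (ih β β.2).1.1) (fun β => ?_) fun β γ h => ?_).2
        · refine (closure_mono ?_).trans (ih β β.2).2.1
          rintro _ ⟨γ, hγ, rfl⟩
          exact ⟨γ, hγ, rfl⟩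
        · rcases h.eq_or_lt with rfl | h
          · exact (ih β β.2).2.2.2.1
          · exact (ih γ γ.2).2.2.2.2 _ ⟨β, h, rfl⟩
      · rintro _ ⟨β, hβ, rfl⟩
        exact (ih β hβ).2.2.1
      · exact Cardinal.mk_image_le.trans_lt (hIio α)
      · rintro _ ⟨β, hβ, rfl⟩
        exact (ih β hβ).1
      · exact Cardinal.mk_image_le.trans_lt (hIio α)
  obtain ⟨hinj, hfree⟩ := injective_and_isFreeSet_range (x := fun α => (q α).1)
    (U := fun α => (q α).2) (fun α => (hgood α).1.1) (fun α => (hgood α).2.1) fun α β h => by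
      rcases h.eq_or_lt with rfl | h
      · exact (hgood α).2.2.2.1
      · exact (hgood β).2.2.2.2 _ ⟨α, h, rfl⟩
  have hcard : #(Set.range fun α => (q α).1) = lift.{u + 1} κ :=
    (Cardinal.mk_range_eq _ hinj).trans hι
  exact ⟨hcard ▸ card_lt_freenessHat hfree, _, hfree, hcard⟩
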